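/- Let $R$ be a unital ring. A $(\mathbb Z\times\mathbb Z)$-bigraded exact couple of left $R$-modules consists of bigraded modules $D,E$ and morphisms $i:D\to D$, $j:D\to E$, $k:E\to D$ of bidegrees $a,b,c\in\mathbb Z\times\mathbb Z$ (so $i_x:D_x\to D_{x+a}$, and so on) such that the triangle $D\xrightarrow{i}D\xrightarrow{j}E\xrightarrow{k}D\xrightarrow{i}D$ is exact in every position. It is regular if $\sigma=\det[a\ \ b+c]\in\{1,-1\}$. Image subobjects: $I^0_y=D_y$, $I^{\tau+1}_y=i(I^\tau_{y-a})$, and $I^\tau_y=\bigcap_{\rho<\tau}I^\rho_y$ for limit ordinals $\tau$; thus $I^\omega_y=\bigcap_{r}\operatorname{Im}(i^r:D_{y-ra}\to D_y)$. For all sufficiently large ordinals $\alpha$ the $I^\alpha$ are constant; the stable value is $\bar I_y$. Image quotients: $Q^0_y=D_y$, $Q^{\tau+1}_y=\operatorname{Im}(Q^\tau_y\to Q^\tau_{y+a})$, and $Q^\tau_y=\operatorname{colim}_{\rho<\tau}Q^\rho_y$ for limit ordinals $\tau$. Put $Z^\tau_{x+b}=k^{-1}(I^\tau_{x+b+c})$,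 $B^\tau_{x+b}=j(\operatorname{Ker}(D_x\to Q^\tau_x))$ and $E^{\tau+1}=Z^\tau/B^\tau$. The stable $E$-object $\bar E$ is $E^{\alpha+1}$ for any sufficiently large ordinal $\alpha$. The object $E^\infty=\bigcap_r Z^r/\bigcup_r B^r$ is the limit page of the spectral sequence of the exact couple, whose page $E^{r+1}=Z^r/B^r$ ($r\ge 0$ finite) has the differential induced by the additive relation $j\circ(i^r)^{-1}\circ k$. One has $\bar E\subseteq E^\infty$. Finally, for $n\in\mathbb Z$, $L^n$ is the limit of the diagram $D(n)$ formed by the objects $D_z$ with $\det[a\ \ z]=n$ and the maps $i$ between them. **Lemma (stable E-infinity extension).** Let $(E,D,i,j,k)$ be a regular exact couple, let $x\in\mathbb Z\times\mathbb Z$ and put $y=x+b+c$. The following are equivalent: (i) the inclusion $\bar E_{x+b}\to E^\infty_{x+b}$ is an isomorphism; (ii) the map $\lim^1_r\operatorname{Ker}(i^r:D_{y-ra}\to D_y)\to\lim^1_r\operatorname{Ker}(i^{r+1}:D_{y-ra}\to D_{y+a})$ induced by the inclusions of kernels is injective, where the transition maps of both towers are the restrictions of $i:D_{y-(r+1)a}\to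 D_{y-ra}$; (iii) $\bar I_y\cap\operatorname{Ker}(i_y)=I^\omega_y\cap\operatorname{Ker}(i_y)$ as submodules of $D_y$. **Corollary.** In this situation, (i) holds whenever at least one of the following conditions is satisfied: (1) with $n=\det[a\ \ x]$, the structure map $L^{n+\sigma}\to I^\omega_y$ is surjective; (2) the restriction of $i_y$ to $I^\omega_y$ is injective; (3) $i_y$ is injective; (4) ($\omega$-Mittag-Leffler condition) $I^{\omega+1}_{y+ra}=I^\omega_{y+ra}$ for all $r\in\mathbb Z$; (5) (Mittag-Leffler condition) for every $r\in\mathbb Z$ there is $m\in\mathbb N$ with $I^\tau_{y+ra}=I^m_{y+ra}$ for all ordinals $\tau\ge m$. -/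

import Mathlib

open Ordinal

universe u v w

/-! ### The derived functor `lim¹` of a tower `⋯ → K 2 → K 1 → K 0` of modules -/

section LimOne

variable {R : Type u} [Ring R] {K L : ℕ → Type v}
  [∀ r, AddCommGroup (K r)] [∀ r, Module R (K r)]
  [∀ r, AddCommGroup (L r)] [∀ r, Module R (L r)]

/-- The map `∏ K r → ∏ K r`, `(t r) ↦ (t r - f r (t (r + 1)))`; its kernel is `lim K`. -/
def limOneDiff (f : ∀ r, K (r + 1) →ₗ[R] K r) : (∀ r, K r) →ₗ[R] (∀ r, K r) :=
  LinearMap.pi fun r => LinearMap.proj r - f r ∘ₗ LinearMap.proj (r + 1)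

/-- `lim¹ K`: the cokernel of `limOneDiff`. -/
abbrev LimOne (f : ∀ r, K (r + 1) →ₗ[R] K r) : Type v :=
  (∀ r, K r) ⧸ LinearMap.range (limOneDiff f)

/-- The map induced on `lim¹` by a morphism of towers. -/
def LimOne.map (f : ∀ r, K (r + 1) →ₗ[R] K r) (g : ∀ r, L (r + 1) →ₗ[R] L r)
    (φ : ∀ r, K r →ₗ[R] L r) (h : ∀ r (t : K (r + 1)), φ r (f r t) = g r (φ (r + 1) t)) :
    LimOne f →ₗ[R] LimOne g :=
  Submodule.mapQ _ _ (LinearMap.pi fun r => φ r ∘ₗ LinearMap.proj r) (by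
    rintro _ ⟨t, rfl⟩
    refine ⟨fun r => φ r (t r), ?_⟩
    funext r
    simp [limOneDiff, h])

end LimOne

/-- The determinant of the `2 × 2` integer matrix with columns `p` and `q`. -/
def colDet (p q : ℤ × ℤ) : ℤ := Matrix.det !![p.1, q.1; p.2, q.2]

/-- A `(ℤ × ℤ)`-bigraded exact couple of `R`-modules, with structure maps `i`, `j`, `k` of
bidegrees `a`, `b`, `c`.  A morphism of bidegree `a` is a family of linear maps
`D x → D (x + a)`; it is written as `i h : D x → D y` for `h : x + a = y`, which is the same
thing and avoids transport along equalities of indices. -/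
structure BigradedExactCouple (R : Type u) [Ring R] (D : ℤ × ℤ → Type v) (E : ℤ × ℤ → Type w)
    [∀ x, AddCommGroup (D x)] [∀ x, Module R (D x)]
    [∀ x, AddCommGroup (E x)] [∀ x, Module R (E x)] where
  a : ℤ × ℤ
  b : ℤ × ℤ
  c : ℤ × ℤ
  i : ∀ {x y : ℤ × ℤ}, x + a = y → (D x →ₗ[R] D y)
  j : ∀ {x y : ℤ × ℤ}, x + b = y → (D x →ₗ[R] E y)
  k : ∀ {x y : ℤ × ℤ}, x + c = y → (E x →ₗ[R] D y)
  exact_ij : ∀ {x y z : ℤ × ℤ} (h : x + a = y) (h' : y + b = z), Function.Exact (i h) (j h')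
  exact_jk : ∀ {x y z : ℤ × ℤ} (h : x + b = y) (h' : y + c = z), Function.Exact (j h) (k h')
  exact_ki : ∀ {x y z : ℤ × ℤ} (h : x + c = y) (h' : y + a = z), Function.Exact (k h) (i h')

namespace BigradedExactCouple

variable {R : Type u} [Ring R] {D : ℤ × ℤ → Type v} {E : ℤ × ℤ → Type w}
  [∀ x, AddCommGroup (D x)] [∀ x, Module R (D x)]
  [∀ x, AddCommGroup (E x)] [∀ x, Module R (E x)]
  (C : BigradedExactCouple R D E)

/-- The number `σ = det [a  b + c]`. -/
def sigma : ℤ := colDet C.a (C.b + C.c)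

/-- The exact couple is regular if `σ ∈ {1, -1}`. -/
def IsRegular : Prop := C.sigma = 1 ∨ C.sigma = -1

/-- The iterate `i^n : D x → D (x + n a)`. -/
def iIter : (n : ℕ) → {x y : ℤ × ℤ} → x + n • C.a = y → (D x →ₗ[R] D y)
  | 0, x, _, h => (show x = _ by simpa using h) ▸ LinearMap.id
  | n + 1, x, _, h => iIter n (x := x + C.a) (by rw [← h, succ_nsmul]; abel) ∘ₗ C.i rfl

/-! ### The limit abutment -/

/-- The limit abutment `L^n`: the limit of the diagram `D(n)`, which consists of the objects
`D z` with `det [a z] = n` and the maps `i` between them. -/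
def limAbut (n : ℤ) : Submodule R (∀ z : {z : ℤ × ℤ // colDet C.a z = n}, D z) where
  carrier := {t | ∀ (z z' : {z : ℤ × ℤ // colDet C.a z = n}) (h : (z : ℤ × ℤ) + C.a = z'),
    C.i h (t z) = t z'}
  zero_mem' := fun z z' h => by simp
  add_mem' := fun {s t} hs ht z z' h => by simp [hs z z' h, ht z z' h]
  smul_mem' := fun r t ht z z' h => by simp [ht z z' h]

/-- The cone map `L^n → D z`, where `n = det [a z]`. -/
def limAbutMap (z : ℤ × ℤ) : C.limAbut (colDet C.a z) →ₗ[R] D z :=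
  LinearMap.proj (φ := fun z' : {z' : ℤ × ℤ // colDet C.a z' = colDet C.a z} => D z') ⟨z, rfl⟩ ∘ₗ
    (C.limAbut (colDet C.a z)).subtype

/-! ### Transfinite image subobjects and image quotients -/

/-- The `τ`-th image subobject `I^τ` of `D y`, taken in the diagram
`⋯ → D (y - a) → D y → D (y + a) → ⋯`: `I^0 = D`, `I^(τ+1)` is the image under `i` of `I^τ`,
and at limit ordinals one takes intersections. -/
noncomputable def img (τ : Ordinal.{v}) : ∀ y : ℤ × ℤ, Submodule R (D y) :=
  Ordinal.limitRecOn τ (fun _ => ⊤)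
    (fun _ S y => (S (y - C.a)).map (C.i (sub_add_cancel y C.a)))
    (fun τ _ S y => ⨅ (ρ : Ordinal.{v}) (h : ρ < τ), S ρ h y)

/-- The kernel of the quotient map from `D y` to the `τ`-th image quotient `Q^τ`:
`Q^0 = D`, `Q^(τ+1)` is the image of `Q^τ` in its translate along `i`, and at limit ordinals one
takes colimits of quotients. -/
noncomputable def quoKer (τ : Ordinal.{v}) : ∀ y : ℤ × ℤ, Submodule R (D y) :=
  Ordinal.limitRecOn τ (fun _ => ⊥)
    (fun _ S y => (S (y + C.a)).comap (C.i rfl))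
    (fun τ _ S y => ⨆ (ρ : Ordinal.{v}) (h : ρ < τ), S ρ h y)

/-- Cycles of order `τ`: the preimage under `k` of `I^τ`. -/
noncomputable def cyc (τ : Ordinal.{v}) (x : ℤ × ℤ) : Submodule R (E x) :=
  (C.img τ (x + C.c)).comap (C.k rfl)

/-- Boundaries of order `τ`: the image under `j` of the kernel of `D → Q^τ`. -/
noncomputable def bdry (τ : Ordinal.{v}) (x : ℤ × ℤ) : Submodule R (E x) :=
  (C.quoKer τ (x - C.b)).map (C.j (sub_add_cancel x C.b))

/-- The least infinite ordinal at which all the image subobjects become stationary. -/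
noncomputable def stableOrdinal : Ordinal.{v} :=
  sInf {α | ω ≤ α ∧ ∀ β, α ≤ β → ∀ y, C.img β y = C.img α y}

/-- The stable image subobject `Ī` of `D y`. -/
noncomputable def stableImg (y : ℤ × ℤ) : Submodule R (D y) := C.img C.stableOrdinal y

/-- The stable `E`-object `Ē = E^(α+1) = Z^α / B^α`, where `α` is the stabilization ordinal. -/
abbrev StableE (x : ℤ × ℤ) : Type w :=
  C.cyc C.stableOrdinal x ⧸ (C.bdry C.stableOrdinal x).submoduleOf (C.cyc C.stableOrdinal x)

/-! ### The spectral sequence and its limit page -/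

/-- The pair `(Z^r, B^r)` of cycles and boundaries of the spectral sequence, inside `E`.
With `Z^0 = E`, `B^0 = 0`, the page `E^(r+1)` is `Z^r / B^r`, and its differential is induced by
the additive relation `Δ = j ∘ (i^r)⁻¹ ∘ k`.  Then `Z^(r+1)` is the preimage in `Z^r` of the kernel
of the differential that leaves, and `B^(r+1)` the preimage of the image of the one that arrives. -/
def ssCycBdry : ℕ → (∀ x, Submodule R (E x)) × (∀ x, Submodule R (E x))
  | 0 => (fun _ => ⊤, fun _ => ⊥)
  | r + 1 =>
    (fun x => (ssCycBdry r).1 x ⊓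
      ((((ssCycBdry r).2 (x + C.c - r • C.a + C.b)).comap (C.j rfl)).map
        (C.iIter r (sub_add_cancel (x + C.c) (r • C.a)))).comap (C.k rfl),
     fun x => (ssCycBdry r).2 x ⊔
      ((((ssCycBdry r).1 (x - C.b + r • C.a - C.c)).map
        (C.k (sub_add_cancel (x - C.b + r • C.a) C.c))).comap (C.iIter r rfl)).map
          (C.j (sub_add_cancel x C.b)))

/-- `Z^r` for the spectral sequence. -/
def ssCyc (r : ℕ) (x : ℤ × ℤ) : Submodule R (E x) := (C.ssCycBdry r).1 x

/-- `B^r` for the spectral sequence. -/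
def ssBdry (r : ℕ) (x : ℤ × ℤ) : Submodule R (E x) := (C.ssCycBdry r).2 x

/-- `Z^∞ = ⋂ Z^r`. -/
def cycInf (x : ℤ × ℤ) : Submodule R (E x) := ⨅ r, C.ssCyc r x

/-- `B^∞ = ⋃ B^r`. -/
def bdryInf (x : ℤ × ℤ) : Submodule R (E x) := ⨆ r, C.ssBdry r x

/-- The `E`-infinity object `E^∞ = Z^∞ / B^∞` of the spectral sequence. -/
abbrev EInf (x : ℤ × ℤ) : Type w := C.cycInf x ⧸ (C.bdryInf x).submoduleOf (C.cycInf x)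

/-! ### Facts needed to see that `Ē` is well defined and maps to `E^∞` -/

theorem iIter_congr {n : ℕ} {x y y' : ℤ × ℤ} (h : x + n • C.a = y) (h' : x + n • C.a = y')
    (d : D x) : C.iIter n h d = 0 ↔ C.iIter n h' d = 0 := by
  subst h; subst h'; rfl

theorem i_iIter (n : ℕ) : ∀ {x y z : ℤ × ℤ} (h : x + n • C.a = y) (h' : y + C.a = z)
    (h'' : x + (n + 1) • C.a = z) (d : D x),
    C.i h' (C.iIter n h d) = C.iIter (n + 1) h'' d := by
  induction n with
  | zero =>
    intro x y z h h' h'' d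
    obtain rfl : x = y := by simpa using h
    subst h'
    rfl
  | succ n ih =>
    intro x y z h h' h'' d
    exact ih _ h' (by rw [← h'', succ_nsmul C.a (n + 1)]; abel) _

theorem img_zero (y : ℤ × ℤ) : C.img 0 y = ⊤ := by
  rw [img, Ordinal.limitRecOn_zero]

theorem img_succ (τ : Ordinal.{v}) (y : ℤ × ℤ) :
    C.img (τ + 1) y = (C.img τ (y - C.a)).map (C.i (sub_add_cancel y C.a)) := by
  rw [img, Ordinal.limitRecOn_add_one]; rfl

theorem img_limit {τ : Ordinal.{v}} (h : Order.IsSuccLimit τ) (y : ℤ × ℤ) :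
    C.img τ y = ⨅ (ρ : Ordinal.{v}) (_ : ρ < τ), C.img ρ y := by
  rw [img, Ordinal.limitRecOn_limit _ _ _ _ h]; rfl

theorem quoKer_zero (y : ℤ × ℤ) : C.quoKer 0 y = ⊥ := by
  rw [quoKer, Ordinal.limitRecOn_zero]

theorem quoKer_succ (τ : Ordinal.{v}) (y : ℤ × ℤ) :
    C.quoKer (τ + 1) y = (C.quoKer τ (y + C.a)).comap (C.i rfl) := by
  rw [quoKer, Ordinal.limitRecOn_add_one]; rfl

theorem quoKer_limit {τ : Ordinal.{v}} (h : Order.IsSuccLimit τ) (y : ℤ × ℤ) :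
    C.quoKer τ y = ⨆ (ρ : Ordinal.{v}) (_ : ρ < τ), C.quoKer ρ y := by
  rw [quoKer, Ordinal.limitRecOn_limit _ _ _ _ h]; rfl

theorem img_succ_le (τ : Ordinal.{v}) : ∀ y, C.img (τ + 1) y ≤ C.img τ y := by
  induction τ using Ordinal.limitRecOn with
  | zero => intro y; rw [img_zero]; exact le_top
  | add_one τ ih =>
    intro y d hd
    rw [img_succ C (τ + 1)] at hd
    rw [img_succ C τ]
    obtain ⟨t, ht, rfl⟩ := hd
    exact ⟨t, ih _ ht, rfl⟩
  | limit τ hτ ih =>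
    intro y
    rw [img_limit C hτ]
    refine le_iInf₂ fun ρ hρ => le_trans ?_ (ih ρ hρ y)
    intro d hd
    rw [img_succ C τ] at hd
    rw [img_succ C ρ]
    obtain ⟨t, ht, rfl⟩ := hd
    rw [img_limit C hτ] at ht
    exact ⟨t, (iInf₂_le ρ hρ : _ ≤ C.img ρ (y - C.a)) ht, rfl⟩

theorem img_antitone {σ τ : Ordinal.{v}} (h : σ ≤ τ) : ∀ y, C.img τ y ≤ C.img σ y := by
  induction τ using Ordinal.limitRecOn with
  | zero => intro y; rw [nonpos_iff_eq_zero.mp h]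
  | add_one τ ih =>
    intro y
    rcases h.lt_or_eq with h | h
    · exact (C.img_succ_le τ y).trans (ih (Order.lt_add_one_iff.mp h) y)
    · rw [h]
  | limit τ hτ ih =>
    intro y
    rcases h.lt_or_eq with h | h
    · rw [img_limit C hτ]; exact iInf₂_le σ h
    · rw [h]

theorem img_stable_of_succ {α : Ordinal.{v}} (h : ∀ y, C.img (α + 1) y = C.img α y)
    (β : Ordinal.{v}) (hβ : α ≤ β) : ∀ y, C.img β y = C.img α y := by
  induction β using Ordinal.limitRecOn with
  | zero => intro y; rw [nonpos_iff_eq_zero.mp hβ]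
  | add_one β ih =>
    intro y
    rcases hβ.lt_or_eq with hβ | hβ
    · rw [img_succ, ih (Order.lt_add_one_iff.mp hβ), ← img_succ, h]
    · rw [hβ]
  | limit β hl ih =>
    intro y
    refine le_antisymm (C.img_antitone hβ y) ?_
    rw [img_limit C hl]
    refine le_iInf₂ fun ρ hρ => ?_
    rcases le_total α ρ with hαρ | hαρ
    · rw [ih ρ hρ hαρ]
    · exact C.img_antitone hαρ y

theorem exists_stable :
    ∃ α : Ordinal.{v}, ω ≤ α ∧ ∀ β, α ≤ β → ∀ y, C.img β y = C.img α y := by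
  by_contra hcon
  have hne : ∀ α : Ordinal.{v}, ω ≤ α → ∃ y, C.img (α + 1) y ≠ C.img α y := by
    intro α hα
    by_contra hc
    push Not at hc
    exact hcon ⟨α, hα, C.img_stable_of_succ hc⟩
  refine not_injective_of_ordinal
    (fun τ : Ordinal.{v} => (fun y => C.img (ω + τ) y : ∀ y, Submodule R (D y))) ?_
  have key : ∀ σ τ : Ordinal.{v}, σ < τ →
      (fun y => C.img (ω + σ) y) ≠ (fun y => C.img (ω + τ) y) := by
    intro σ τ hlt heq
    obtain ⟨y, hy⟩ := hne (ω + σ) le_self_add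
    apply hy
    refine le_antisymm (C.img_succ_le _ y) ?_
    have h1 := congrFun heq y
    change C.img (ω + σ) y = C.img (ω + τ) y at h1
    rw [h1]
    apply C.img_antitone
    rw [add_assoc]
    gcongr
    exact Order.add_one_le_of_lt hlt
  intro σ τ heq
  rcases lt_trichotomy σ τ with h | h | h
  · exact (key σ τ h heq).elim
  · exact h
  · exact (key τ σ h heq.symm).elim

theorem stableOrdinal_spec :
    ω ≤ C.stableOrdinal ∧
      ∀ β, C.stableOrdinal ≤ β → ∀ y, C.img β y = C.img C.stableOrdinal y :=
  csInf_mem (s := {α : Ordinal.{v} | ω ≤ α ∧ ∀ β, α ≤ β → ∀ y, C.img β y = C.img α y})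
    C.exists_stable

theorem exists_of_mem_img_nat (n : ℕ) : ∀ {x y : ℤ × ℤ} (h : x + n • C.a = y) (d : D y),
    d ∈ C.img (n : Ordinal.{v}) y → ∃ t : D x, C.iIter n h t = d := by
  induction n with
  | zero =>
    intro x y h d _
    obtain rfl : x = y := by simpa using h
    exact ⟨d, rfl⟩
  | succ n ih =>
    intro x y h d hd
    rw [Nat.cast_add_one, img_succ] at hd
    obtain ⟨s, hs, rfl⟩ := hd
    obtain ⟨t, rfl⟩ := ih (x := x) (by rw [← h, succ_nsmul]; abel) s hs
    exact ⟨t, (C.i_iIter n _ _ _ t).symm⟩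

theorem mem_ssCyc_of_img (r : ℕ) (x : ℤ × ℤ) (e : E x)
    (h : C.k rfl e ∈ C.img (r : Ordinal.{v}) (x + C.c)) : e ∈ C.ssCyc r x := by
  induction r with
  | zero => exact Submodule.mem_top
  | succ r ih =>
    have h' := h
    rw [Nat.cast_add_one] at h
    refine Submodule.mem_inf.mpr ⟨ih (C.img_succ_le _ _ h), ?_⟩
    obtain ⟨t, ht⟩ := C.exists_of_mem_img_nat (r + 1)
      (x := x + C.c - r • C.a - C.a) (by rw [succ_nsmul]; abel) _ h'
    refine ⟨C.i (sub_add_cancel _ _) t, ?_, ?_⟩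
    · have h0 := (C.exact_ij (sub_add_cancel (x + C.c - r • C.a) C.a) rfl).apply_apply_eq_zero t
      simp only [SetLike.mem_coe, Submodule.mem_comap, h0, Submodule.zero_mem]
    · rw [← ht]
      have gen : ∀ {p q s : ℤ × ℤ} (h1 : p + C.a = q) (h2 : q + r • C.a = s)
          (h3 : p + (r + 1) • C.a = s) (t : D p),
          C.iIter r h2 (C.i h1 t) = C.iIter (r + 1) h3 t := by
        intro p q s h1 h2 h3 t
        subst h1
        rfl
      exact gen _ _ _ t

theorem mem_ssBdry_of_iIter (r : ℕ) (x : ℤ × ℤ) (d : D (x - C.b))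
    (h : C.iIter r rfl d = 0) : C.j (sub_add_cancel x C.b) d ∈ C.ssBdry r x := by
  cases r with
  | zero =>
    have hd : d = 0 := by
      have gen : ∀ {p q : ℤ × ℤ} (h1 : p + 0 • C.a = q) (t : D p), C.iIter 0 h1 t = 0 → t = 0 := by
        intro p q h1 t ht
        obtain rfl : p = q := by simpa using h1
        exact ht
      exact gen _ d h
    rw [hd, map_zero]
    exact Submodule.zero_mem _
  | succ r =>
    refine Submodule.mem_sup_right ⟨d, ?_, rfl⟩
    have h1 : C.i rfl (C.iIter r (rfl : x - C.b + r • C.a = _) d) = 0 := by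
      rw [C.i_iIter r rfl rfl (by rw [succ_nsmul, add_assoc]) d]
      exact (C.iIter_congr _ _ d).mp h
    obtain ⟨e, he⟩ :=
      (C.exact_ki (sub_add_cancel (x - C.b + r • C.a) C.c) rfl _).mp h1
    refine ⟨e, ?_, he⟩
    refine C.mem_ssCyc_of_img r _ e ?_
    have gen : ∀ (n : ℕ) {p q : ℤ × ℤ} (h1 : p + n • C.a = q) (t : D p),
        C.iIter n h1 t ∈ C.img (n : Ordinal.{v}) q := by
      intro n
      induction n with
      | zero => intro p q h1 t; rw [Nat.cast_zero, img_zero]; exact Submodule.mem_top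
      | succ n ih =>
        intro p q h1 t
        rw [Nat.cast_add_one, img_succ]
        have h2 : p + n • C.a = q - C.a := by rw [← h1, succ_nsmul]; abel
        exact ⟨C.iIter n h2 t, ih h2 t, C.i_iIter n _ _ _ t⟩
    have gen2 : ∀ {p q q' : ℤ × ℤ} (e : E p) (h1 : p + C.c = q) (h2 : p + C.c = q'),
        C.k h1 e ∈ C.img (r : Ordinal.{v}) q → C.k h2 e ∈ C.img (r : Ordinal.{v}) q' := by
      intro p q q' e h1 h2 h
      subst h1; subst h2; exact h
    refine gen2 e _ rfl (he ▸ gen r _ d)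

theorem mem_quoKer (τ : Ordinal.{v}) :
    ∀ (y : ℤ × ℤ) (d : D y), d ∈ C.quoKer τ y → ∃ n : ℕ, C.iIter n rfl d = 0 := by
  have mono : ∀ {n m : ℕ} {y : ℤ × ℤ} {d : D y}, n ≤ m → C.iIter n rfl d = 0 →
      C.iIter m rfl d = 0 := by
    intro n m y d hnm h
    induction m, hnm using Nat.le_induction with
    | base => exact h
    | succ m _ ih =>
      rw [← C.i_iIter m rfl (by rw [succ_nsmul, add_assoc]) rfl d, ih, map_zero]
  induction τ using Ordinal.limitRecOn with
  | zero =>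
    intro y d hd
    rw [quoKer_zero, Submodule.mem_bot] at hd
    exact ⟨0, by rw [hd, map_zero]⟩
  | add_one τ ih =>
    intro y d hd
    rw [quoKer_succ] at hd
    obtain ⟨n, hn⟩ := ih _ _ hd
    refine ⟨n + 1, ?_⟩
    have h1 : y + (n + 1) • C.a = y + C.a + n • C.a := by rw [succ_nsmul]; abel
    exact (C.iIter_congr (n := n + 1) h1 rfl d).mp hn
  | limit τ hτ ih =>
    intro y d hd
    let S : Submodule R (D y) :=
      { carrier := {d | ∃ n : ℕ, C.iIter n rfl d = 0}
        zero_mem' := ⟨0, map_zero _⟩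
        add_mem' := by
          rintro s t ⟨n, hn⟩ ⟨m, hm⟩
          refine ⟨max n m, ?_⟩
          rw [map_add, mono (le_max_left n m) hn, mono (le_max_right n m) hm, add_zero]
        smul_mem' := by
          rintro r s ⟨n, hn⟩
          exact ⟨n, by rw [map_smul, hn, smul_zero]⟩ }
    have hle : C.quoKer τ y ≤ S := by
      rw [quoKer_limit C hτ]
      exact iSup₂_le fun ρ hρ d hd => ih ρ hρ y d hd
    exact hle hd

theorem cyc_le_cycInf {α : Ordinal.{v}} (hα : ω ≤ α) (x : ℤ × ℤ) : C.cyc α x ≤ C.cycInf x :=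
  le_iInf fun r _ he => C.mem_ssCyc_of_img r x _
    (C.img_antitone ((Ordinal.natCast_lt_omega0 r).le.trans hα) _ he)

theorem bdry_le_bdryInf (α : Ordinal.{v}) (x : ℤ × ℤ) : C.bdry α x ≤ C.bdryInf x := by
  rintro _ ⟨d, hd, rfl⟩
  obtain ⟨n, hn⟩ := C.mem_quoKer α _ d hd
  exact (le_iSup (fun r => C.ssBdry r x) n) (C.mem_ssBdry_of_iIter n x d hn)

/-- The inclusion `Ē → E^∞`: the map of quotients induced by `Z^α ⊆ Z^∞`. -/
noncomputable def stableToInf (x : ℤ × ℤ) : C.StableE x →ₗ[R] C.EInf x :=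
  Submodule.mapQ _ _ (Submodule.inclusion (C.cyc_le_cycInf C.stableOrdinal_spec.1 x))
    (fun e he => C.bdry_le_bdryInf C.stableOrdinal x (show (e : E x) ∈ _ from he))

/-! ### The towers of kernels -/

/-- The submodule `Ker (i^n : D z → D (z + n a))`. -/
def iterKer (n : ℕ) (z : ℤ × ℤ) : Submodule R (D z) :=
  LinearMap.ker (C.iIter n (rfl : z + n • C.a = z + n • C.a))

theorem i_mem_iterKer (n : ℕ) {z z' : ℤ × ℤ} (h : z + C.a = z') (d : D z)
    (hd : d ∈ C.iterKer (n + 1) z) : C.i h d ∈ C.iterKer n z' := by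
  subst h
  exact (C.iIter_congr (n := n) (x := z + C.a) _ _ (C.i rfl d)).mp hd

theorem iterKer_le_succ (n : ℕ) (z : ℤ × ℤ) : C.iterKer n z ≤ C.iterKer (n + 1) z := by
  intro d hd
  have h0 : C.iIter n rfl d = 0 := hd
  have h1 := C.i_iIter n rfl (by rw [succ_nsmul, add_assoc]) (rfl : z + (n + 1) • C.a = _) d
  rw [h0, map_zero] at h1
  exact h1.symm

theorem sub_succ_nsmul_add (y : ℤ × ℤ) (r : ℕ) :
    y - (r + 1) • C.a + C.a = y - r • C.a := by
  rw [succ_nsmul]; abel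

/-- The `r`-th object `Ker (i^(s+r) : D (y - r a) → D (y + s a))` of a tower of kernels. -/
def kerTower (y : ℤ × ℤ) (s r : ℕ) : Submodule R (D (y - r • C.a)) :=
  C.iterKer (s + r) (y - r • C.a)

/-- The transition maps of the tower of kernels: the restrictions of
`i : D (y - (r + 1) a) → D (y - r a)`. -/
def kerTransition (y : ℤ × ℤ) (s r : ℕ) : C.kerTower y s (r + 1) →ₗ[R] C.kerTower y s r :=
  (C.i (C.sub_succ_nsmul_add y r)).restrict fun d hd => C.i_mem_iterKer (s + r) _ d hd

/-- `lim¹` over `r` of the tower `r ↦ Ker (i^(s+r) : D (y - r a) → D (y + s a))`. -/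
abbrev LimOneKer (y : ℤ × ℤ) (s : ℕ) : Type v :=
  LimOne (R := R) (K := fun r => C.kerTower y s r) (C.kerTransition y s)

theorem kerTower_le (y : ℤ × ℤ) (r : ℕ) : C.kerTower y 0 r ≤ C.kerTower y 1 r := by
  rw [kerTower, kerTower, zero_add, add_comm 1 r]
  exact C.iterKer_le_succ r _

/-- The map `lim¹ Ker (i^r) → lim¹ Ker (i^(r+1))` induced by the inclusions
`Ker (i^r) → Ker (i^(r+1))` of submodules of `D (y - r a)`. -/
def limOneKerMap (y : ℤ × ℤ) : C.LimOneKer y 0 →ₗ[R] C.LimOneKer y 1 :=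
  LimOne.map (R := R) (K := fun r => C.kerTower y 0 r) (L := fun r => C.kerTower y 1 r)
    (C.kerTransition y 0) (C.kerTransition y 1)
    (fun r => Submodule.inclusion (C.kerTower_le y r)) (fun _ _ => rfl)

/-! ### Mittag-Leffler conditions -/

/-- The diagram `r ↦ D (y + r a)`, `r ∈ ℤ`, satisfies the Mittag-Leffler condition. -/
def MittagLeffler (y : ℤ × ℤ) : Prop :=
  ∀ r : ℤ, ∃ n : ℕ, ∀ τ : Ordinal.{v}, (n : Ordinal.{v}) ≤ τ →
    C.img τ (y + r • C.a) = C.img n (y + r • C.a)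

/-- The diagram `r ↦ D (y + r a)`, `r ∈ ℤ`, satisfies the `μ`-Mittag-Leffler condition:
`I^(μ+1) = I^μ`. -/
def OrdinalMittagLeffler (μ : Ordinal.{v}) (y : ℤ × ℤ) : Prop :=
  ∀ r : ℤ, C.img (μ + 1) (y + r • C.a) = C.img μ (y + r • C.a)

end BigradedExactCouple

namespace BigradedExactCouple

variable {R : Type u} [Ring R] {D : ℤ × ℤ → Type v} {E : ℤ × ℤ → Type w}
  [∀ x, AddCommGroup (D x)] [∀ x, Module R (D x)]
  [∀ x, AddCommGroup (E x)] [∀ x, Module R (E x)]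
  (C : BigradedExactCouple R D E)

/-! ### Iterates of `i` -/

/-! Each of the three conditions is equivalent to the single inclusion `I^ω_y ∩ Ker i_y ⊆ Ī_y`.

For the map of `E`-objects, exactness identifies `Z^r` with `k⁻¹(I^r)` (`mem_ssCyc_iff`), hence
`Z^∞` with `k⁻¹(I^ω)`. The boundaries do not change beyond `ω`, so `Ē → E^∞` is always injective,
and it is onto iff `k⁻¹(I^ω) ⊆ k⁻¹(Ī)`. Since `Im k = Ker i`, this is the inclusion above
(`stableToInf_bijective_iff`).

For `lim¹`, `Ī_y` consists of the elements that extend backwards to an infinite `i`-compatible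
sequence (`mem_stableImg_iff`). An element `d` of `I^ω_y` has preimages `t r` under every `i^r`,
perhaps incompatible; the defects `t r - i (t (r + 1))` lie in `Ker i^r` and define a class in `lim¹
Ker i^r`, which vanishes iff the `t r` can be corrected to a compatible sequence. If `i d = 0`, then
`t r` lies in `Ker i^(r+1)`, so the class dies in the second `lim¹`; every class that dies there
arises in this way (`limOneKerMap_injective_iff`).

Each condition of the corollary forces either `I^ω_y ∩ Ker i_y = 0` or `I^ω_y ⊆ Ī_y`. -/

theorem iIter_succ_apply (n : ℕ) {x y z : ℤ × ℤ} (h : x + C.a = y) (h' : y + n • C.a = z)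
    (h'' : x + (n + 1) • C.a = z) (d : D x) :
    C.iIter n h' (C.i h d) = C.iIter (n + 1) h'' d := by
  subst h
  rfl

theorem iIter_zero_eq_zero {x y : ℤ × ℤ} (h : x + 0 • C.a = y) {d : D x}
    (hd : C.iIter 0 h d = 0) : d = 0 := by
  obtain rfl : x = y := by simpa using h
  exact hd

theorem exists_mem_iIter_zero (S : ∀ x, Submodule R (D x)) {x y : ℤ × ℤ} (h : x + 0 • C.a = y)
    {d : D y} (hd : d ∈ S y) : ∃ t ∈ S x, C.iIter 0 h t = d := by
  obtain rfl : x = y := by simpa using h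
  exact ⟨d, hd, rfl⟩

theorem iIter_eq_zero_congr {n m : ℕ} (hnm : n = m) {x y z : ℤ × ℤ} (h : x + n • C.a = y)
    (h' : x + m • C.a = z) (d : D x) : C.iIter n h d = 0 ↔ C.iIter m h' d = 0 := by
  subst hnm
  exact (C.iIter_congr h (h.trans (h.symm.trans h')) d).trans (by subst h; subst h'; rfl)

theorem iIter_mem_img (n : ℕ) : ∀ {x y : ℤ × ℤ} (h : x + n • C.a = y) (d : D x),
    C.iIter n h d ∈ C.img (n : Ordinal.{v}) y := by
  induction n with
  | zero => intro x y h d; rw [Nat.cast_zero, img_zero]; exact Submodule.mem_top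
  | succ n ih =>
    intro x y h d
    rw [Nat.cast_add_one, img_succ]
    have h' : x + n • C.a = y - C.a := by rw [← h, succ_nsmul]; abel
    exact ⟨C.iIter n h' d, ih h' d, C.i_iIter n _ _ _ d⟩

theorem mem_img_omega_iff (y : ℤ × ℤ) (d : D y) :
    d ∈ C.img ω y ↔ ∀ n : ℕ, d ∈ C.img (n : Ordinal.{v}) y := by
  refine ⟨fun h n => C.img_antitone (Ordinal.natCast_lt_omega0 n).le y h, fun h => ?_⟩
  rw [img_limit C Ordinal.isSuccLimit_omega0]
  simp only [Submodule.mem_iInf]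
  intro ρ hρ
  obtain ⟨n, rfl⟩ := Ordinal.lt_omega0.mp hρ
  exact h n

/-! ### Cycles and boundaries of the spectral sequence -/

/-- A newly added boundary is `j d` with `i^r d` in `Im k = Ker i`, so `i^(r+1) d = 0`; older
boundaries come from smaller kernels. -/
theorem exists_of_mem_ssBdry (r : ℕ) {x z : ℤ × ℤ} (h : z + C.b = x) {e : E x}
    (he : e ∈ C.ssBdry r x) : ∃ d : D z, d ∈ C.iterKer r z ∧ C.j h d = e := by
  obtain rfl : z = x - C.b := eq_sub_of_add_eq h
  induction r generalizing e with
  | zero =>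
    rw [ssBdry, ssCycBdry, Submodule.mem_bot] at he
    exact ⟨0, Submodule.zero_mem _, by rw [map_zero, he]⟩
  | succ r ih =>
    obtain ⟨e₁, he₁, e₂, he₂, rfl⟩ := Submodule.mem_sup.mp he
    obtain ⟨d₁, hd₁, rfl⟩ := ih he₁
    obtain ⟨d₂, ⟨f, -, hf⟩, rfl⟩ := he₂
    refine ⟨d₁ + d₂, Submodule.add_mem _ (C.iterKer_le_succ r _ hd₁) ?_, map_add _ _ _⟩
    have h0 := C.i_iIter r rfl rfl (by rw [succ_nsmul, add_assoc]) d₂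
    rw [← hf, (C.exact_ki _ rfl).apply_apply_eq_zero f] at h0
    exact (C.iIter_congr _ _ d₂).mp h0.symm

theorem mem_ssCyc_iff (r : ℕ) (x : ℤ × ℤ) (e : E x) :
    e ∈ C.ssCyc r x ↔ C.k rfl e ∈ C.img (r : Ordinal.{v}) (x + C.c) := by
  refine ⟨fun h => ?_, C.mem_ssCyc_of_img r x e⟩
  cases r with
  | zero => rw [Nat.cast_zero, img_zero]; exact Submodule.mem_top
  | succ r =>
    obtain ⟨t, ht, hte⟩ := h.2
    -- Here `k e = i^r t` with `j t` in `B^r`. Subtracting some `d` in `Ker i^r` with `j d = j t`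
    -- leaves `i^r t` unchanged and puts `t - d` in `Ker j = Im i`, which gains one more factor of
    -- `i`.
    obtain ⟨d, hd, hdt⟩ := C.exists_of_mem_ssBdry r rfl (e := C.j rfl t) ht
    have h0 : C.j (rfl : x + C.c - r • C.a + C.b = _) (t - d) = 0 := by
      rw [map_sub, hdt, _root_.sub_self]
    obtain ⟨s, hs⟩ := (C.exact_ij (sub_add_cancel (x + C.c - r • C.a) C.a) rfl _).mp h0
    have hd0 : C.iIter r (sub_add_cancel (x + C.c) (r • C.a)) d = 0 :=
      (C.iIter_eq_zero_congr rfl _ _ d).mp hd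
    have hts : C.iIter r (sub_add_cancel (x + C.c) (r • C.a)) t = C.k rfl e := hte
    rw [← hts, ← sub_add_cancel t d, map_add, hd0, add_zero, ← hs,
      C.iIter_succ_apply r _ _ (by rw [succ_nsmul]; abel) s]
    exact C.iIter_mem_img (r + 1) _ s

theorem mem_cycInf_iff (x : ℤ × ℤ) (e : E x) :
    e ∈ C.cycInf x ↔ C.k rfl e ∈ C.img ω (x + C.c) := by
  rw [cycInf, Submodule.mem_iInf, mem_img_omega_iff]
  exact forall_congr' fun r => C.mem_ssCyc_iff r x e

theorem mem_quoKer_nat (n : ℕ) : ∀ {x y : ℤ × ℤ} (h : x + n • C.a = y) (d : D x),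
    C.iIter n h d = 0 → d ∈ C.quoKer (n : Ordinal.{v}) x := by
  induction n with
  | zero =>
    intro x y h d hd
    rw [C.iIter_zero_eq_zero h hd]
    exact Submodule.zero_mem _
  | succ n ih =>
    intro x y h d hd
    rw [Nat.cast_add_one, quoKer_succ]
    refine ih (y := y) (by rw [← h, succ_nsmul]; abel) _ ?_
    rwa [C.iIter_succ_apply n _ _ h]

/-- The colimit at `ω` already kills everything that some finite iterate kills. This persists at
later successors because `i d` is killed by the same `i^n` as `d`. -/
theorem mem_quoKer_of_omega_le {τ : Ordinal.{v}} (hτ : ω ≤ τ) (n : ℕ) :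
    ∀ {x y : ℤ × ℤ} (h : x + n • C.a = y) (d : D x), C.iIter n h d = 0 → d ∈ C.quoKer τ x := by
  induction τ using Ordinal.limitRecOn with
  | zero => exact absurd hτ (not_le.mpr Ordinal.omega0_pos)
  | add_one τ ih =>
    intro x y h d hd
    rcases hτ.lt_or_eq with hτ | hτ
    · rw [quoKer_succ]
      refine ih (Order.lt_add_one_iff.mp hτ) (y := y + C.a) (by rw [← h]; abel) _ ?_
      rw [C.iIter_succ_apply n _ _ (by rw [← h, succ_nsmul]; abel), ← C.i_iIter n h rfl, hd,
        map_zero]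
    · exact absurd (hτ ▸ Ordinal.isSuccLimit_omega0) (Order.not_isSuccLimit_add_one τ)
  | limit τ hl ih =>
    intro x y h d hd
    rw [quoKer_limit C hl]
    exact (le_iSup₂_of_le (f := fun (ρ : Ordinal.{v}) (_ : ρ < τ) => C.quoKer ρ x) (n : Ordinal.{v})
      ((Ordinal.natCast_lt_omega0 n).trans_le hτ) le_rfl) (C.mem_quoKer_nat n h d hd)

theorem bdryInf_le_bdry {α : Ordinal.{v}} (hα : ω ≤ α) (x : ℤ × ℤ) :
    C.bdryInf x ≤ C.bdry α x := by
  refine iSup_le fun r e he => ?_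
  obtain ⟨d, hd, rfl⟩ := C.exists_of_mem_ssBdry r (sub_add_cancel x C.b) he
  exact ⟨d, C.mem_quoKer_of_omega_le hα r rfl d hd, rfl⟩

/-- Boundaries lie in `Im j = Ker k`, and zero belongs to every `I^α`. -/
theorem bdryInf_le_cyc (α : Ordinal.{v}) (x : ℤ × ℤ) : C.bdryInf x ≤ C.cyc α x := by
  refine iSup_le fun r e he => ?_
  obtain ⟨d, -, rfl⟩ := C.exists_of_mem_ssBdry r (sub_add_cancel x C.b) he
  change C.k rfl (C.j _ d) ∈ C.img α (x + C.c)
  rw [(C.exact_jk _ rfl).apply_apply_eq_zero d]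
  exact Submodule.zero_mem _

theorem stableToInf_injective (x : ℤ × ℤ) : Function.Injective (C.stableToInf x) := by
  rw [← LinearMap.ker_eq_bot, LinearMap.ker_eq_bot']
  intro q hq
  obtain ⟨e, rfl⟩ := Submodule.Quotient.mk_surjective _ q
  have h : (e : E x) ∈ C.bdryInf x :=
    (Submodule.Quotient.mk_eq_zero ((C.bdryInf x).submoduleOf (C.cycInf x))).mp hq
  exact (Submodule.Quotient.mk_eq_zero _).mpr (C.bdryInf_le_bdry C.stableOrdinal_spec.1 x h)

/-- Because `B^∞` is contained in `Z^α`, an element of `Z^∞` congruent modulo `B^∞` to an element of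
`Z^α` is itself in `Z^α`. -/
theorem stableToInf_surjective_iff (x : ℤ × ℤ) :
    Function.Surjective (C.stableToInf x) ↔ C.cycInf x ≤ C.cyc C.stableOrdinal x := by
  constructor
  · intro h e he
    obtain ⟨q, hq⟩ := h (Submodule.Quotient.mk ⟨e, he⟩)
    obtain ⟨z, rfl⟩ := Submodule.Quotient.mk_surjective _ q
    have h1 : (z : E x) - e ∈ C.bdryInf x :=
      (Submodule.Quotient.eq ((C.bdryInf x).submoduleOf (C.cycInf x))).mp hq
    have h2 := Submodule.sub_mem _ z.2 (C.bdryInf_le_cyc C.stableOrdinal x h1)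
    rwa [sub_sub_cancel] at h2
  · intro h q
    obtain ⟨e, rfl⟩ := Submodule.Quotient.mk_surjective _ q
    exact ⟨Submodule.Quotient.mk ⟨e, h e.2⟩, rfl⟩

theorem stableToInf_bijective_iff {x y : ℤ × ℤ} (h : x + C.c = y) :
    Function.Bijective (C.stableToInf x) ↔
      C.img ω y ⊓ LinearMap.ker (C.i (rfl : y + C.a = y + C.a)) ≤ C.stableImg y := by
  subst h
  rw [Function.Bijective, and_iff_right (C.stableToInf_injective x), stableToInf_surjective_iff]
  constructor
  · rintro hle d ⟨hd, hk⟩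
    obtain ⟨e, rfl⟩ := (C.exact_ki rfl rfl d).mp hk
    exact hle ((C.mem_cycInf_iff x e).mpr hd)
  · intro hle e he
    exact hle ⟨(C.mem_cycInf_iff x e).mp he, (C.exact_ki rfl rfl).apply_apply_eq_zero e⟩

/-! ### Stable image subobjects and compatible sequences -/

theorem stableImg_le_img_omega (y : ℤ × ℤ) : C.stableImg y ≤ C.img ω y :=
  C.img_antitone C.stableOrdinal_spec.1 y

/-- Stability at the next ordinal says that `i` maps `Ī` onto `Ī`. -/
theorem exists_mem_stableImg {x y : ℤ × ℤ} (h : x + C.a = y) {d : D y} (hd : d ∈ C.stableImg y) :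
    ∃ t ∈ C.stableImg x, C.i h t = d := by
  obtain rfl : x = y - C.a := eq_sub_of_add_eq h
  rw [stableImg, ← C.stableOrdinal_spec.2 _ le_self_add y, img_succ] at hd
  exact hd

/-- The induction treats all `r` at once, since the successor step for `u r` uses its lift `u (r +
1)`. -/
theorem mem_img_of_compatible {y : ℤ × ℤ} {u : ∀ r : ℕ, D (y - r • C.a)}
    (hu : ∀ r, C.i (C.sub_succ_nsmul_add y r) (u (r + 1)) = u r) (τ : Ordinal.{v}) :
    ∀ r, u r ∈ C.img τ (y - r • C.a) := by
  induction τ using Ordinal.limitRecOn with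
  | zero => intro r; rw [img_zero]; exact Submodule.mem_top
  | add_one τ ih =>
    intro r
    rw [← hu r, img_succ]
    have gen : ∀ {p q : ℤ × ℤ} (h : p + C.a = q) (t : D p), t ∈ C.img τ p →
        C.i h t ∈ (C.img τ (q - C.a)).map (C.i (sub_add_cancel q C.a)) := by
      intro p q h t ht
      obtain rfl : p = q - C.a := eq_sub_of_add_eq h
      exact ⟨t, ht, rfl⟩
    exact gen _ _ (ih (r + 1))
  | limit τ hτ ih =>
    intro r
    rw [img_limit C hτ]
    simp only [Submodule.mem_iInf]
    exact fun ρ hρ => ih ρ hρ r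

theorem iIter_of_compatible {y : ℤ × ℤ} {u : ∀ r : ℕ, D (y - r • C.a)}
    (hu : ∀ r, C.i (C.sub_succ_nsmul_add y r) (u (r + 1)) = u r) (r : ℕ) :
    C.iIter r (sub_add_cancel y (r • C.a)) (u r) =
      C.iIter 0 (sub_add_cancel y (0 • C.a)) (u 0) := by
  induction r with
  | zero => rfl
  | succ r ih =>
    rw [← ih, ← hu r, C.iIter_succ_apply r _ _ (sub_add_cancel y ((r + 1) • C.a))]

/-- Lifts within `Ī` always exist, so dependent choice builds the sequence; conversely, a compatible
sequence survives every transfinite image. Here `C.iIter 0` only transports from index `y - 0 • a`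
to `y`. -/
theorem mem_stableImg_iff (y : ℤ × ℤ) (d : D y) :
    d ∈ C.stableImg y ↔ ∃ u : ∀ r : ℕ, D (y - r • C.a),
      (∀ r, C.i (C.sub_succ_nsmul_add y r) (u (r + 1)) = u r) ∧
        C.iIter 0 (sub_add_cancel y (0 • C.a)) (u 0) = d := by
  constructor
  · intro hd
    obtain ⟨t, ht, rfl⟩ :=
      C.exists_mem_iIter_zero C.stableImg (sub_add_cancel y (0 • C.a)) hd
    choose g hg hig using fun r (s : C.stableImg (y - r • C.a)) =>
      C.exists_mem_stableImg (C.sub_succ_nsmul_add y r) s.2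
    let u : ∀ r : ℕ, C.stableImg (y - r • C.a) :=
      fun r => Nat.rec ⟨t, ht⟩ (fun r s => ⟨g r s, hg r s⟩) r
    refine ⟨fun r => (u r).1, fun r => hig r (u r), ?_⟩
    rfl
  · rintro ⟨u, hu, rfl⟩
    have gen : ∀ {p q : ℤ × ℤ} (h : p + 0 • C.a = q) (t : D p), t ∈ C.stableImg p →
        C.iIter 0 h t ∈ C.stableImg q := by
      intro p q h t ht
      obtain rfl : p = q := by simpa using h
      exact ht
    exact gen _ _ (C.mem_img_of_compatible hu _ 0)

/-! ### The map of `lim¹` of kernel towers -/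

theorem mem_kerTower_zero_iff (y : ℤ × ℤ) (r : ℕ) (d : D (y - r • C.a)) :
    d ∈ C.kerTower y 0 r ↔ C.iIter r (sub_add_cancel y (r • C.a)) d = 0 :=
  C.iIter_eq_zero_congr (zero_add r) _ _ d

theorem mem_kerTower_one_iff (y : ℤ × ℤ) (r : ℕ) (d : D (y - r • C.a)) :
    d ∈ C.kerTower y 1 r ↔
      C.i (rfl : y + C.a = y + C.a) (C.iIter r (sub_add_cancel y (r • C.a)) d) = 0 := by
  rw [C.i_iIter r _ _ (by rw [succ_nsmul]; abel)]
  exact C.iIter_eq_zero_congr (add_comm 1 r) _ _ d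

theorem limOneKerMap_injective_iff (y : ℤ × ℤ) :
    Function.Injective (C.limOneKerMap y) ↔
      C.img ω y ⊓ LinearMap.ker (C.i (rfl : y + C.a = y + C.a)) ≤ C.stableImg y := by
  rw [← LinearMap.ker_eq_bot, LinearMap.ker_eq_bot']
  constructor
  · rintro hinj d ⟨hd, hk⟩
    choose t ht using fun r : ℕ => C.exists_of_mem_img_nat r (sub_add_cancel y (r • C.a)) d
      ((C.mem_img_omega_iff y d).mp hd r)
    have hstep (r : ℕ) : C.iIter r (sub_add_cancel y (r • C.a))
        (C.i (C.sub_succ_nsmul_add y r) (t (r + 1))) = d := by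
      rw [C.iIter_succ_apply r _ _ (sub_add_cancel y ((r + 1) • C.a)), ht]
    -- The failure of the chosen preimages of `d` to be compatible, as an element of the product of
    -- the kernels `Ker i^r`.
    let κ : ∀ r, C.kerTower y 0 r := fun r =>
      ⟨t r - C.i (C.sub_succ_nsmul_add y r) (t (r + 1)), by
        rw [mem_kerTower_zero_iff, map_sub, ht, hstep, _root_.sub_self]⟩
    have h0 : C.limOneKerMap y (Submodule.Quotient.mk κ) = 0 := by
      refine (Submodule.Quotient.mk_eq_zero _).mpr ⟨fun r => ⟨t r, ?_⟩, ?_⟩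
      · rw [mem_kerTower_one_iff, ht]
        exact hk
      · funext r
        rfl
    have h1 := hinj _ h0
    rw [Submodule.Quotient.mk_eq_zero] at h1
    obtain ⟨s, hs⟩ := h1
    have hs' (r : ℕ) : (s r : D (y - r • C.a)) - C.i (C.sub_succ_nsmul_add y r) (s (r + 1)) =
        t r - C.i (C.sub_succ_nsmul_add y r) (t (r + 1)) :=
      congrArg Subtype.val (congrFun hs r)
    -- Since `s` has the same defect as `t`, the difference is compatible; it still lies over `d`
    -- because `s 0` is zero.
    refine (C.mem_stableImg_iff y d).mpr ⟨fun r => t r - s r, fun r => ?_, ?_⟩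
    · rw [map_sub, sub_eq_sub_iff_add_eq_add]
      have := hs' r
      rw [sub_eq_sub_iff_add_eq_add] at this
      rw [add_comm, this]
    · rw [map_sub, ht, (C.mem_kerTower_zero_iff y 0 _).mp (s 0).2, _root_.sub_zero]
  · intro hle q hq
    obtain ⟨κ, rfl⟩ := Submodule.Quotient.mk_surjective _ q
    obtain ⟨t, ht⟩ := (Submodule.Quotient.mk_eq_zero _).mp hq
    have ht' (r : ℕ) : (t r : D (y - r • C.a)) - C.i (C.sub_succ_nsmul_add y r) (t (r + 1)) = κ r :=
      congrArg Subtype.val (congrFun ht r)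
    -- As `κ r` lies in `Ker i^r`, all the `t r` are preimages of this one element. It is killed by
    -- `i` because `t 0` lies in the kernel of `i^1`.
    set d : D y := C.iIter 0 (sub_add_cancel y (0 • C.a)) (t 0) with hd
    have htd (r : ℕ) : C.iIter r (sub_add_cancel y (r • C.a)) (t r : D (y - r • C.a)) = d := by
      induction r with
      | zero => rfl
      | succ r ih =>
        have h0 := (C.mem_kerTower_zero_iff y r _).mp (κ r).2
        rw [← ht', map_sub, ih,
          C.iIter_succ_apply r _ _ (sub_add_cancel y ((r + 1) • C.a)), sub_eq_zero] at h0
        exact h0.symm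
    obtain ⟨u, hu, hud⟩ := (C.mem_stableImg_iff y d).mp (hle
      ⟨(C.mem_img_omega_iff y d).mpr fun n => by rw [← htd n]; exact C.iIter_mem_img n _ _,
        (C.mem_kerTower_one_iff y 0 _).mp (t 0).2⟩)
    rw [Submodule.Quotient.mk_eq_zero]
    -- Both `t r` and `u r` lie over `d`, so their difference is in `Ker i^r`; `u` being compatible,
    -- the defect is still `κ`.
    refine ⟨fun r => ⟨t r - u r, ?_⟩, ?_⟩
    · rw [mem_kerTower_zero_iff, map_sub, htd, C.iIter_of_compatible hu, hud, _root_.sub_self]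
    · funext r
      apply Subtype.ext
      change (t r - u r : D (y - r • C.a)) -
        C.i (C.sub_succ_nsmul_add y r) (t (r + 1) - u (r + 1)) = κ r
      rw [map_sub, hu, ← ht' r]
      abel

/-! ### Sufficient conditions -/

/-- The component of a thread at `y` is the image under `i` of its component at `y - a`, which
belongs to the same diagram because `det [a a] = 0`. -/
theorem range_limAbutMap_le_img (τ : Ordinal.{v}) :
    ∀ y, LinearMap.range (C.limAbutMap y) ≤ C.img τ y := by
  induction τ using Ordinal.limitRecOn with
  | zero => intro y; rw [img_zero]; exact le_top
  | add_one τ ih =>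
    rintro y _ ⟨t, rfl⟩
    rw [img_succ]
    have hdet : colDet C.a (y - C.a) = colDet C.a y := by
      simp only [colDet, Matrix.det_fin_two_of, Prod.fst_sub, Prod.snd_sub]
      ring
    have gen : ∀ (n : ℤ) (hn : colDet C.a (y - C.a) = n) (s : C.limAbut n),
        (s : ∀ z : {z : ℤ × ℤ // colDet C.a z = n}, D z) ⟨y - C.a, hn⟩ ∈ C.img τ (y - C.a) := by
      rintro _ rfl s
      exact ih _ ⟨s, rfl⟩
    exact ⟨_, gen _ hdet t, t.2 ⟨y - C.a, hdet⟩ ⟨y, rfl⟩ (sub_add_cancel y C.a)⟩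
  | limit τ hτ ih =>
    intro y
    rw [img_limit C hτ]
    exact le_iInf₂ fun ρ hρ => ih ρ hρ y

/-- Equality at `r` for a successor ordinal needs equality at `r - 1` for its predecessor, hence the
quantifier over all integers inside the induction. -/
theorem OrdinalMittagLeffler.img_eq {C : BigradedExactCouple R D E} {μ : Ordinal.{v}} {y : ℤ × ℤ}
    (h : C.OrdinalMittagLeffler μ y) (τ : Ordinal.{v}) (hτ : μ ≤ τ) :
    ∀ r : ℤ, C.img τ (y + r • C.a) = C.img μ (y + r • C.a) := by
  induction τ using Ordinal.limitRecOn with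
  | zero => intro r; rw [nonpos_iff_eq_zero.mp hτ]
  | add_one τ ih =>
    intro r
    rcases hτ.lt_or_eq with hτ | hτ
    · have hr : y + r • C.a - C.a = y + (r - 1) • C.a := by rw [sub_smul, one_smul]; abel
      have hi : C.img τ (y + r • C.a - C.a) = C.img μ (y + r • C.a - C.a) := by
        rw [hr]; exact ih (Order.lt_add_one_iff.mp hτ) (r - 1)
      rw [img_succ, hi, ← img_succ, h r]
    · rw [hτ]
  | limit τ hl ih =>
    intro r
    refine le_antisymm (C.img_antitone hτ _) ?_
    rw [img_limit C hl]
    refine le_iInf₂ fun ρ hρ => ?_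
    rcases le_total μ ρ with hμρ | hμρ
    · rw [ih ρ hρ hμρ r]
    · exact C.img_antitone hμρ _

theorem MittagLeffler.img_omega_le {C : BigradedExactCouple R D E} {y : ℤ × ℤ}
    (h : C.MittagLeffler y) : C.img ω y ≤ C.stableImg y := by
  obtain ⟨n, hn⟩ := h 0
  have h0 := hn _ ((Ordinal.natCast_lt_omega0 n).le.trans C.stableOrdinal_spec.1)
  rw [show y + (0 : ℤ) • C.a = y by simp] at h0
  rw [stableImg, h0]
  exact C.img_antitone (Ordinal.natCast_lt_omega0 n).le y

theorem OrdinalMittagLeffler.img_omega_le {C : BigradedExactCouple R D E} {y : ℤ × ℤ}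
    (h : C.OrdinalMittagLeffler ω y) : C.img ω y ≤ C.stableImg y := by
  have h0 := h.img_eq _ C.stableOrdinal_spec.1 0
  rw [show y + (0 : ℤ) • C.a = y by simp] at h0
  exact h0.ge

end BigradedExactCouple

theorem mainTheorem4 {R : Type u} [Ring R] {D : ℤ × ℤ → Type v} {E : ℤ × ℤ → Type w}
    [∀ x, AddCommGroup (D x)] [∀ x, Module R (D x)]
    [∀ x, AddCommGroup (E x)] [∀ x, Module R (E x)]
    (C : BigradedExactCouple R D E) (hC : C.IsRegular) (x y : ℤ × ℤ)
    (hy : x + C.b + C.c = y) :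
    List.TFAE
      [Function.Bijective (C.stableToInf (x + C.b)),
       Function.Injective (C.limOneKerMap y),
       C.stableImg y ⊓ LinearMap.ker (C.i (rfl : y + C.a = y + C.a)) =
         C.img ω y ⊓ LinearMap.ker (C.i (rfl : y + C.a = y + C.a))] ∧
    (C.img ω y ≤ LinearMap.range (C.limAbutMap y) ∨
      Function.Injective ((C.i (rfl : y + C.a = y + C.a)).domRestrict (C.img ω y)) ∨
      Function.Injective (C.i (rfl : y + C.a = y + C.a)) ∨
      C.OrdinalMittagLeffler ω y ∨
      C.MittagLeffler y →
      Function.Bijective (C.stableToInf (x + C.b))) := by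
  have h13 := C.stableToInf_bijective_iff hy
  have h23 := C.limOneKerMap_injective_iff y
  have hle : C.stableImg y ⊓ LinearMap.ker (C.i (rfl : y + C.a = y + C.a)) =
        C.img ω y ⊓ LinearMap.ker (C.i (rfl : y + C.a = y + C.a)) ↔
      C.img ω y ⊓ LinearMap.ker (C.i (rfl : y + C.a = y + C.a)) ≤ C.stableImg y :=
    ⟨fun h => h ▸ inf_le_left, fun h => le_antisymm
      (inf_le_inf_right _ (C.stableImg_le_img_omega y)) (le_inf h inf_le_right)⟩
  refine ⟨?_, ?_⟩
  · tfae_have 1 ↔ 3 := h13.trans hle.symm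
    tfae_have 2 ↔ 3 := h23.trans hle.symm
    tfae_finish
  · intro h
    refine h13.mpr ?_
    rcases h with h | h | h | h | h
    -- By bilinearity `det [a y] = det [a x] + σ`, so the range in `h` is the image of `L^(n+σ)`.
    -- Threads have components in every `I^τ`, in particular in `Ī`.
    · exact inf_le_left.trans (h.trans (C.range_limAbutMap_le_img _ y))
    · rintro d ⟨hd, hk⟩
      have h0 : (⟨d, hd⟩ : C.img ω y) = 0 := h (by rw [map_zero]; exact hk)
      rw [show d = 0 from congrArg Subtype.val h0]
      exact Submodule.zero_mem _
    · rintro d ⟨-, hk⟩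
      rw [h (hk.trans (map_zero _).symm)]
      exact Submodule.zero_mem _
    · exact inf_le_left.trans h.img_omega_le
    · exact inf_le_left.trans h.img_omega_le
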